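/- Let $\mathbb{H}=\{z\in\mathbb{C}:\operatorname{Im} z>0\}$ and let $f\colon\mathbb{H}\to\mathbb{H}$ be a parabolic holomorphic map with Denjoy-Wolff point at infinity; that is, $f$ is holomorphic, has no fixed point in $\mathbb{H}$, its iterates $f^n$ converge to $\infty$ uniformly on compact subsets of $\mathbb{H}$, and the angular (non-tangential) limit $\angle\lim_{z\to\infty} f(z)/z$ equals $1$. Write $f$ in its Herglotz form $$f(z)=z+\beta+\int_{\mathbb{R}}\frac{1+tz}{t-z}\,d\mu(t),\qquad z\in\mathbb{H},$$ where $\beta\in\mathbb{R}$ and $\mu$ is a finite positive Borel measure on $\mathbb{R}$. Say that $f$ is of finite shift if there is a point $z_0\in\mathbb{H}$ such that $\sup_{n\ge 0}\operatorname{Im} f^n(z_0)<+\infty$. If $f$ is of finite shift, then $\int_{\mathbb{R}}|t|\,d\mu(t)<+\infty$. Moreover, $f$ is of finite shift if and only if one of the following holds: (i) $\int_{(-\infty,0)}|t|\,d\mu(t)<+\infty$, $\int_{(0,+\infty)}t^2\,d\mu(t)<+\infty$, and $\beta>\int_{\mathbb{R}}t\,d\mu(t)$; (ii) $\int_{(-\infty,0)}t^2\,d\mu(t)<+\infty$,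 $\int_{(0,+\infty)}|t|\,d\mu(t)<+\infty$, and $\beta<\int_{\mathbb{R}}t\,d\mu(t)$. -/

import Mathlib

open Filter Topology MeasureTheory Set
open scoped UpperHalfPlane Manifold

/-- The angular (non-tangential) limit of `g : ℍ → ℂ` at infinity exists and equals `l`:
`g z` tends to `l` as `|z| → ∞` within each sector `{z : |Re z| ≤ M * Im z}` of the upper
half-plane. -/
def HasAngularLimitAtInfty (g : ℍ → ℂ) (l : ℂ) : Prop :=
  ∀ M : ℝ, Tendsto g
    (comap (fun z : ℍ => ‖(z : ℂ)‖) atTop ⊓ 𝓟 {z : ℍ | |z.re| ≤ M * z.im}) (𝓝 l)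

/-- The iterates `f^n` converge to infinity uniformly on the compact subsets of `ℍ`. -/
def IteratesTendToInfty (f : ℍ → ℍ) : Prop :=
  ∀ K : Set ℍ, IsCompact K → ∀ R : ℝ, ∀ᶠ n : ℕ in atTop, ∀ z ∈ K, R < ‖((f^[n] z : ℍ) : ℂ)‖

/-- `f` is a parabolic holomorphic self-map of the upper half-plane whose Denjoy-Wolff point is
infinity. -/
structure IsParabolicAtInfty (f : ℍ → ℍ) : Prop where
  /-- `f` is holomorphic. -/
  holomorphic : MDifferentiable 𝓘(ℂ) 𝓘(ℂ) f
  /-- `f` is non-elliptic. -/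
  no_fixed_point : ∀ z : ℍ, f z ≠ z
  /-- The Denjoy-Wolff point of `f` is infinity. -/
  denjoy_wolff : IteratesTendToInfty f
  /-- The angular limit of `f z / z` at infinity is `1`. -/
  multiplier : HasAngularLimitAtInfty (fun z => (f z : ℂ) / (z : ℂ)) 1

/-- `f` is of finite shift: some orbit of `f` has bounded imaginary parts. -/
def HasFiniteShift (f : ℍ → ℍ) : Prop :=
  ∃ z₀ : ℍ, BddAbove (Set.range fun n : ℕ => (f^[n] z₀).im)

/-! Write `h` for the displacement `herglotz β μ` and `P` for `weightedPoissonIntegral μ`. Since `Im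
h = Im z * P`, heights along an orbit satisfy `y (n + 1) = y n * (1 + P (z n))`, so they stay
bounded exactly when `∑ P (z n)` converges.

In that case `tendsto_herglotz` shows that `h (z n)` tends to a nonzero real `b`: difference
quotients of `h` are controlled by `P`, so `h (z n)` is a convergent infinite product. The orbit
thus moves horizontally with asymptotic speed `b`, say `b > 0`. Summing the kernel over such an
orbit amounts to integrating `(1 + t ^ 2) / (1 + |x - t|) ^ 2` over `x` from `Re z 0` to infinity,
which has order `t ^ 2` as `t → +∞` and `|t|` as `t → -∞`. By Tonelli these are the moment
conditions on `μ` (`integrable_one_sub_softsign`). They allow `h = β - ∫ t + ∫ (1 + t ^ 2) / (t -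
z)` with a last term vanishing along the orbit, so `b = β - ∫ t`.

Conversely, under these conditions `h` is close to `β - ∫ t > 0` high in the right quadrant; an
orbit started there has steps bounded above and below, and the same comparison bounds `∑ P (z n)`.
The case `b < 0` follows by the reflection `z ↦ -conj z`. -/

/-- The displacement `β + ∫ (1 + t z) / (t - z) dμ(t)` of the map with Herglotz data `(β, μ)`. -/
noncomputable def herglotz (β : ℝ) (μ : Measure ℝ) (z : ℂ) : ℂ :=
  (β : ℂ) + ∫ t : ℝ, (1 + (t : ℂ) * z) / ((t : ℂ) - z) ∂μ

/-- The kernel `(1 + t ^ 2) / |t - z| ^ 2`. -/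
noncomputable def weightedPoissonKernel (z : ℂ) (t : ℝ) : ℝ := (1 + t ^ 2) / ‖(t : ℂ) - z‖ ^ 2

/-- The integral of the kernel `(1 + t ^ 2) / |t - z| ^ 2` against `μ`. -/
noncomputable def weightedPoissonIntegral (μ : Measure ℝ) (z : ℂ) : ℝ := ∫ t, weightedPoissonKernel z t ∂μ

/-- `z` is an orbit in the upper half-plane of the map with Herglotz data `(β, μ)`. -/
structure IsHerglotzOrbit (β : ℝ) (μ : Measure ℝ) (z : ℕ → ℂ) : Prop where
  im_zero_pos : 0 < (z 0).im
  succ_eq : ∀ n, z (n + 1) = z n + herglotz β μ (z n)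

/-! ### Kernel bounds and the displacement -/

lemma normSq_ofReal_sub (t : ℝ) (z : ℂ) : ‖(t : ℂ) - z‖ ^ 2 = (t - z.re) ^ 2 + z.im ^ 2 := by
  rw [Complex.sq_norm, Complex.normSq_apply]
  simp
  ring

lemma im_le_norm_ofReal_sub (t : ℝ) (z : ℂ) : z.im ≤ ‖(t : ℂ) - z‖ := by
  have := (neg_le_abs _).trans (Complex.abs_im_le_norm ((t : ℂ) - z))
  simpa using this

lemma norm_ofReal_sub_pos {z : ℂ} (hz : 0 < z.im) (t : ℝ) : 0 < ‖(t : ℂ) - z‖ :=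
  hz.trans_le (im_le_norm_ofReal_sub t z)

lemma ofReal_sub_ne_zero {z : ℂ} (hz : 0 < z.im) (t : ℝ) : (t : ℂ) - z ≠ 0 :=
  norm_pos_iff.1 (norm_ofReal_sub_pos hz t)

lemma weightedPoissonKernel_nonneg (z : ℂ) (t : ℝ) : 0 ≤ weightedPoissonKernel z t := by
  unfold weightedPoissonKernel; positivity

lemma weightedPoissonIntegral_nonneg (μ : Measure ℝ) (z : ℂ) : 0 ≤ weightedPoissonIntegral μ z :=
  integral_nonneg (weightedPoissonKernel_nonneg z)

lemma weightedPoissonKernel_le {z : ℂ} (hz : 0 < z.im) (t : ℝ) :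
    weightedPoissonKernel z t ≤ 2 + (1 + 2 * z.re ^ 2) / z.im ^ 2 := by
  unfold weightedPoissonKernel
  have h := norm_ofReal_sub_pos hz t
  rw [div_le_iff₀ (by positivity), normSq_ofReal_sub]
  have h1 : (1 + 2 * z.re ^ 2) / z.im ^ 2 * z.im ^ 2 = 1 + 2 * z.re ^ 2 := by field_simp
  have h2 : 0 ≤ (1 + 2 * z.re ^ 2) / z.im ^ 2 := by positivity
  -- The first square encodes `t ^ 2 ≤ 2 * (t - x) ^ 2 + 2 * x ^ 2`.
  nlinarith [sq_nonneg (t - 2 * z.re), mul_nonneg h2 (sq_nonneg (t - z.re)), sq_nonneg z.im]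

@[fun_prop]
lemma measurable_weightedPoissonKernel (z : ℂ) : Measurable (weightedPoissonKernel z) := by
  unfold weightedPoissonKernel; fun_prop

section FiniteMeasure

variable {β : ℝ} {μ : Measure ℝ} [IsFiniteMeasure μ]

lemma integrable_weightedPoissonKernel {z : ℂ} (hz : 0 < z.im) : Integrable (weightedPoissonKernel z) μ :=
  Integrable.of_bound (measurable_weightedPoissonKernel z).aestronglyMeasurable _
    (ae_of_all _ fun t => by
      rw [Real.norm_of_nonneg (weightedPoissonKernel_nonneg z t)]; exact weightedPoissonKernel_le hz t)

lemma integrable_herglotzKernel {z : ℂ} (hz : 0 < z.im) :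
    Integrable (fun t : ℝ => (1 + (t : ℂ) * z) / ((t : ℂ) - z)) μ := by
  refine Integrable.of_bound (C := ‖z‖ + ‖1 + z ^ 2‖ / z.im)
    (Measurable.aestronglyMeasurable (by fun_prop)) (ae_of_all _ fun t => ?_)
  have h : (1 + (t : ℂ) * z) / ((t : ℂ) - z) = z + (1 + z ^ 2) / ((t : ℂ) - z) := by
    have := ofReal_sub_ne_zero hz t
    field_simp
    ring
  rw [h]
  refine (norm_add_le _ _).trans ?_
  rw [norm_div]
  gcongr
  exact im_le_norm_ofReal_sub t z

lemma im_herglotz {z : ℂ} (hz : 0 < z.im) :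
    (herglotz β μ z).im = z.im * weightedPoissonIntegral μ z := by
  have h : (∫ t : ℝ, (1 + (t : ℂ) * z) / ((t : ℂ) - z) ∂μ).im =
      ∫ t : ℝ, ((1 + (t : ℂ) * z) / ((t : ℂ) - z)).im ∂μ :=
    (integral_im (integrable_herglotzKernel hz)).symm
  rw [herglotz, Complex.add_im, Complex.ofReal_im, zero_add, h, weightedPoissonIntegral,
    ← integral_const_mul]
  refine integral_congr_ae (ae_of_all _ fun t => ?_)
  have h0 := norm_ofReal_sub_pos hz t
  simp only [weightedPoissonKernel, Complex.div_im, ← Complex.sq_norm]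
  field_simp
  simp
  ring

/-- The difference quotient of the displacement. -/
noncomputable def herglotzSlope (μ : Measure ℝ) (z w : ℂ) : ℂ :=
  ∫ t : ℝ, (1 + (t : ℂ) ^ 2) / (((t : ℂ) - z) * ((t : ℂ) - w)) ∂μ

lemma herglotz_sub_herglotz {z w : ℂ} (hz : 0 < z.im) (hw : 0 < w.im) :
    herglotz β μ w - herglotz β μ z = (w - z) * herglotzSlope μ z w := by
  rw [herglotz, herglotz, add_sub_add_left_eq_sub,
    ← integral_sub (integrable_herglotzKernel hw) (integrable_herglotzKernel hz),
    herglotzSlope, ← integral_const_mul]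
  refine integral_congr_ae (ae_of_all _ fun t => ?_)
  have h1 := ofReal_sub_ne_zero hz t
  have h2 := ofReal_sub_ne_zero hw t
  field_simp
  ring

/-- Pointwise, `1 / (a * b) ≤ 1 / a ^ 2 + 1 / b ^ 2` for the two distances to `t`. -/
lemma norm_herglotzSlope_le {z w : ℂ} (hz : 0 < z.im) (hw : 0 < w.im) :
    ‖herglotzSlope μ z w‖ ≤ weightedPoissonIntegral μ z + weightedPoissonIntegral μ w := by
  rw [weightedPoissonIntegral, weightedPoissonIntegral,
    ← integral_add (integrable_weightedPoissonKernel hz) (integrable_weightedPoissonKernel hw)]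
  refine norm_integral_le_of_norm_le
    ((integrable_weightedPoissonKernel hz).add (integrable_weightedPoissonKernel hw)) (ae_of_all _ fun t => ?_)
  have h1 := norm_ofReal_sub_pos hz t
  have h2 := norm_ofReal_sub_pos hw t
  have h3 : ‖(1 : ℂ) + (t : ℂ) ^ 2‖ = 1 + t ^ 2 := by
    rw [← Complex.ofReal_pow, ← Complex.ofReal_one, ← Complex.ofReal_add, Complex.norm_real,
      Real.norm_of_nonneg (by positivity)]
  simp only [weightedPoissonKernel, norm_div, norm_mul, h3]
  generalize ‖(t : ℂ) - z‖ = a at *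
  generalize ‖(t : ℂ) - w‖ = b at *
  have h4 : (a * b)⁻¹ ≤ (a ^ 2)⁻¹ + (b ^ 2)⁻¹ := by
    rw [mul_inv, ← inv_pow, ← inv_pow]
    nlinarith [sq_nonneg (a⁻¹ - b⁻¹), sq_nonneg (a⁻¹), sq_nonneg (b⁻¹)]
  have h5 := mul_le_mul_of_nonneg_left h4 (show 0 ≤ 1 + t ^ 2 by positivity)
  simpa only [div_eq_mul_inv, mul_add] using h5

/-! ### Bounded height, summability and asymptotic speed -/

namespace IsHerglotzOrbit

variable {z : ℕ → ℂ}

lemma im_pos (h : IsHerglotzOrbit β μ z) (n : ℕ) : 0 < (z n).im := by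
  induction n with
  | zero => exact h.im_zero_pos
  | succ n ih =>
    rw [h.succ_eq, Complex.add_im, im_herglotz ih]
    have := weightedPoissonIntegral_nonneg μ (z n)
    positivity

lemma im_succ (h : IsHerglotzOrbit β μ z) (n : ℕ) :
    (z (n + 1)).im = (z n).im * (1 + weightedPoissonIntegral μ (z n)) := by
  rw [h.succ_eq, Complex.add_im, im_herglotz (h.im_pos n)]
  ring

lemma monotone_im (h : IsHerglotzOrbit β μ z) : Monotone fun n => (z n).im :=
  monotone_nat_of_le_succ fun n => by
    rw [h.im_succ]
    have := mul_nonneg (h.im_pos n).le (weightedPoissonIntegral_nonneg μ (z n))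
    linarith

/-- Each step raises the height by `y n * P (z n) ≥ y 0 * P (z n)`, and the total rise is bounded.
-/
lemma summable_weightedPoissonIntegral (h : IsHerglotzOrbit β μ z)
    (hb : BddAbove (range fun n => (z n).im)) : Summable fun n => weightedPoissonIntegral μ (z n) := by
  obtain ⟨B, hB⟩ := hb
  refine summable_of_sum_range_le (c := B / (z 0).im) (fun n => weightedPoissonIntegral_nonneg μ _)
    fun n => ?_
  have key : (z 0).im * ∑ i ∈ Finset.range n, weightedPoissonIntegral μ (z i) ≤ (z n).im := by
    induction n with
    | zero => simpa using h.im_zero_pos.le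
    | succ n ih =>
      rw [Finset.sum_range_succ, mul_add, h.im_succ]
      have := mul_le_mul_of_nonneg_right (h.monotone_im (Nat.zero_le n))
        (weightedPoissonIntegral_nonneg μ (z n))
      simp only at this
      linarith
  rw [le_div_iff₀' h.im_zero_pos]
  exact key.trans (hB ⟨n, rfl⟩)

lemma bddAbove_im_of_sum_le (h : IsHerglotzOrbit β μ z) {S : ℝ}
    (hS : ∀ n, ∑ i ∈ Finset.range n, weightedPoissonIntegral μ (z i) ≤ S) :
    BddAbove (range fun n => (z n).im) := by
  refine ⟨(z 0).im * Real.exp S, ?_⟩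
  rintro _ ⟨n, rfl⟩
  have key : (z n).im ≤
      (z 0).im * Real.exp (∑ i ∈ Finset.range n, weightedPoissonIntegral μ (z i)) := by
    induction n with
    | zero => simp
    | succ n ih =>
      rw [Finset.sum_range_succ, Real.exp_add, ← mul_assoc, h.im_succ]
      refine mul_le_mul ih ?_ (by have := weightedPoissonIntegral_nonneg μ (z n); positivity)
        (by have := h.im_zero_pos; positivity)
      rw [add_comm]
      exact Real.add_one_le_exp _
  refine key.trans ?_
  have := h.im_zero_pos
  gcongr
  exact hS n

lemma tendsto_herglotz (h : IsHerglotzOrbit β μ z) (hb : BddAbove (range fun n => (z n).im))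
    (hne : ∀ n, herglotz β μ (z n) ≠ 0) :
    ∃ b : ℝ, b ≠ 0 ∧ Tendsto (fun n => herglotz β μ (z n)) atTop (𝓝 (b : ℂ)) := by
  have hP := h.summable_weightedPoissonIntegral hb
  set K : ℕ → ℂ := fun n => herglotzSlope μ (z n) (z (n + 1)) with hK
  have hstep : ∀ n, herglotz β μ (z (n + 1)) = herglotz β μ (z n) * (1 + K n) := fun n => by
    have h1 := herglotz_sub_herglotz (β := β) (μ := μ) (h.im_pos n) (h.im_pos (n + 1))
    rw [h.succ_eq n, add_sub_cancel_left, ← h.succ_eq n] at h1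
    rw [mul_add, mul_one, ← h1]
    ring
  have hKs : Summable fun n => ‖K n‖ :=
    Summable.of_nonneg_of_le (fun n => norm_nonneg _)
      (fun n => norm_herglotzSlope_le (h.im_pos n) (h.im_pos (n + 1)))
      (hP.add ((summable_nat_add_iff 1).2 hP))
  -- Nonvanishing factors are needed for the infinite product to be nonzero.
  have hK0 : ∀ n, 1 + K n ≠ 0 := fun n h0 => hne (n + 1) (by rw [hstep, h0, mul_zero])
  have hprod : ∀ n, herglotz β μ (z n) =
      herglotz β μ (z 0) * ∏ i ∈ Finset.range n, (1 + K i) := fun n => by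
    induction n with
    | zero => simp
    | succ n ih => rw [hstep, ih, Finset.prod_range_succ, mul_assoc]
  have hlim : Tendsto (fun n => herglotz β μ (z n)) atTop
      (𝓝 (herglotz β μ (z 0) * ∏' i, (1 + K i))) := by
    refine Tendsto.congr (fun n => (hprod n).symm) ?_
    exact ((multipliable_one_add_of_summable hKs).hasProd.tendsto_prod_nat).const_mul _
  set c := herglotz β μ (z 0) * ∏' i, (1 + K i) with hc
  have hc0 : c ≠ 0 := mul_ne_zero (hne 0) (tprod_one_add_ne_zero_of_summable hK0 hKs)
  have him : c.im = 0 := by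
    refine tendsto_nhds_unique ((Complex.continuous_im.tendsto c).comp hlim) ?_
    obtain ⟨B, hB⟩ := hb
    have h2 : Tendsto (fun n => B * weightedPoissonIntegral μ (z n)) atTop (𝓝 0) := by
      simpa using hP.tendsto_atTop_zero.const_mul B
    refine squeeze_zero (fun n => ?_) (fun n => ?_) h2
    · simp only [Function.comp_apply, im_herglotz (h.im_pos n)]
      exact mul_nonneg (h.im_pos n).le (weightedPoissonIntegral_nonneg μ _)
    · simp only [Function.comp_apply, im_herglotz (h.im_pos n)]
      exact mul_le_mul_of_nonneg_right (hB ⟨n, rfl⟩) (weightedPoissonIntegral_nonneg μ _)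
  have hcr : ((c.re : ℝ) : ℂ) = c := Complex.ext (by simp) (by simp [him])
  refine ⟨c.re, fun h0 => hc0 (by rw [← hcr, h0, Complex.ofReal_zero]), ?_⟩
  rw [hcr]
  exact hlim

end IsHerglotzOrbit

end FiniteMeasure

/-! ### A telescoping primitive for the kernel -/

/-- The increasing bounded function `x / (1 + |x|)`, with derivative `1 / (1 + |x|) ^ 2`. -/
noncomputable def softsign (x : ℝ) : ℝ := x / (1 + |x|)

lemma softsign_le_one (x : ℝ) : softsign x ≤ 1 := by
  unfold softsign
  rw [div_le_one (by positivity)]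
  linarith [le_abs_self x]

lemma neg_one_le_softsign (x : ℝ) : -1 ≤ softsign x := by
  unfold softsign
  rw [le_div_iff₀ (by positivity)]
  linarith [neg_abs_le x]

lemma softsign_of_nonneg {x : ℝ} (hx : 0 ≤ x) : softsign x = 1 - 1 / (1 + x) := by
  rw [softsign, abs_of_nonneg hx]
  field_simp
  ring

@[fun_prop]
lemma measurable_softsign : Measurable softsign := by
  unfold softsign; fun_prop

lemma tendsto_softsign_atTop : Tendsto softsign atTop (𝓝 1) := by
  have h : Tendsto (fun x : ℝ => 1 - 1 / (1 + x)) atTop (𝓝 (1 - 0)) :=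
    tendsto_const_nhds.sub (Tendsto.div_atTop tendsto_const_nhds
      (tendsto_atTop_add_const_left _ _ tendsto_id))
  rw [sub_zero] at h
  refine h.congr' ?_
  filter_upwards [eventually_ge_atTop 0] with x hx using (softsign_of_nonneg hx).symm

/-- Over the common denominator the numerator is `v - u` when the signs agree, and `v - u + 2 * |u|
* v` when `u < 0 < v`. -/
lemma le_softsign_sub {u v : ℝ} (h : u ≤ v) :
    (v - u) / ((1 + |u|) * (1 + |v|)) ≤ softsign v - softsign u := by
  unfold softsign
  rw [div_sub_div _ _ (by positivity) (by positivity), mul_comm (1 + |v|) (1 + |u|),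
    div_le_div_iff_of_pos_right (by positivity)]
  rcases abs_cases u with ⟨h1, _⟩ | ⟨h1, _⟩ <;> rcases abs_cases v with ⟨h2, _⟩ | ⟨h2, _⟩ <;>
    rw [h1, h2] <;> nlinarith

lemma monotone_softsign : Monotone softsign := fun u v h => by
  have := le_softsign_sub h
  have h2 : 0 ≤ (v - u) / ((1 + |u|) * (1 + |v|)) :=
    div_nonneg (sub_nonneg.2 h) (by positivity)
  linarith

/-- Steps of bounded length contribute at most the derivative, up to a constant. -/
lemma softsign_sub_le {u v H : ℝ} (hH : 0 ≤ H) (h : v ≤ u + H) :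
    softsign v - softsign u ≤ H * (1 + H) ^ 2 / (1 + |u|) ^ 2 := by
  rcases le_total v u with hvu | huv
  · have := monotone_softsign hvu
    have h2 : 0 ≤ H * (1 + H) ^ 2 / (1 + |u|) ^ 2 := by positivity
    linarith
  have hu : 1 + |u| ≤ (1 + H) * (1 + |v|) := by
    have : |u| ≤ |v| + H := by
      have := abs_sub_abs_le_abs_sub u v
      rw [abs_of_nonpos (show u - v ≤ 0 by linarith)] at this
      linarith
    nlinarith [abs_nonneg v]
  -- For opposite signs the extra term `2 * |u| * v` is at most `H ^ 2`, since `|u| + v ≤ H`.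
  have h1 : softsign v - softsign u ≤ H * (1 + H) / ((1 + |u|) * (1 + |v|)) := by
    unfold softsign
    rw [div_sub_div _ _ (by positivity) (by positivity), mul_comm (1 + |v|) (1 + |u|),
      div_le_div_iff_of_pos_right (by positivity)]
    rcases abs_cases u with ⟨h1, _⟩ | ⟨h1, _⟩ <;> rcases abs_cases v with ⟨h2, _⟩ | ⟨h2, _⟩ <;>
      rw [h1, h2] <;> nlinarith
  refine h1.trans ?_
  rw [div_le_div_iff₀ (by positivity) (by positivity)]
  calc H * (1 + H) * (1 + |u|) ^ 2 = (H * (1 + H) * (1 + |u|)) * (1 + |u|) := by ring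
    _ ≤ (H * (1 + H) * (1 + |u|)) * ((1 + H) * (1 + |v|)) := by gcongr
    _ = _ := by ring

/-- Steps of length bounded above and below contribute at least the derivative, up to a
constant. -/
lemma le_softsign_sub_of_step {u v a H : ℝ} (ha : 0 ≤ a) (h1 : u + a ≤ v) (h2 : v ≤ u + H) :
    a / (1 + H) / (1 + |u|) ^ 2 ≤ softsign v - softsign u := by
  refine le_trans ?_ (le_softsign_sub (by linarith))
  have hv : 1 + |v| ≤ (1 + H) * (1 + |u|) := by
    have : |v| ≤ |u| + H := by
      have := abs_sub_abs_le_abs_sub v u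
      rw [abs_of_nonneg (show 0 ≤ v - u by linarith)] at this
      linarith
    nlinarith [abs_nonneg u]
  have hH : 0 ≤ H := by linarith
  rw [div_div]
  refine div_le_div₀ (by linarith) (by linarith) (by positivity) ?_
  calc (1 + |u|) * (1 + |v|) ≤ (1 + |u|) * ((1 + H) * (1 + |u|)) := by gcongr
    _ = _ := by ring

lemma le_weightedPoissonKernel {z : ℂ} {B : ℝ} (hz : 0 < z.im) (hB : z.im ≤ B) (t : ℝ) :
    (1 + t ^ 2) / ((1 + B) ^ 2 * (1 + |z.re - t|) ^ 2) ≤ weightedPoissonKernel z t := by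
  unfold weightedPoissonKernel
  have := norm_ofReal_sub_pos hz t
  refine div_le_div_of_nonneg_left (by positivity) (by positivity) ?_
  rw [normSq_ofReal_sub, ← mul_pow, ← sq_abs (t - z.re), abs_sub_comm]
  have h0 := abs_nonneg (z.re - t)
  have h1 : z.im ^ 2 ≤ B ^ 2 := by gcongr
  have hB0 : 0 ≤ B := by linarith
  nlinarith [mul_nonneg hB0 h0, mul_nonneg hB0 (sq_nonneg |z.re - t|),
    mul_nonneg (mul_nonneg hB0 hB0) (sq_nonneg |z.re - t|), mul_nonneg (mul_nonneg hB0 hB0) h0]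

lemma weightedPoissonKernel_le_of_one_le_im {z : ℂ} (hz : 1 ≤ z.im) (t : ℝ) :
    weightedPoissonKernel z t ≤ 2 * (1 + t ^ 2) / (1 + |z.re - t|) ^ 2 := by
  unfold weightedPoissonKernel
  have := norm_ofReal_sub_pos (by linarith) t
  rw [div_le_div_iff₀ (by positivity) (by positivity), normSq_ofReal_sub,
    ← sq_abs (t - z.re), abs_sub_comm t]
  have h0 : (1 + |z.re - t|) ^ 2 ≤ 2 * (|z.re - t| ^ 2 + z.im ^ 2) := by
    nlinarith [sq_nonneg (|z.re - t| - 1)]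
  calc _ ≤ (1 + t ^ 2) * (2 * (|z.re - t| ^ 2 + z.im ^ 2)) := by gcongr
    _ = _ := by ring

lemma one_sub_softsign_ge (a t : ℝ) :
    (1 + |t|) / (2 * (1 + |a|)) ≤ (1 + t ^ 2) * (1 - softsign (a - t)) := by
  have h1 : softsign (a - t) ≤ softsign (|a| + |t|) :=
    monotone_softsign (by linarith [le_abs_self a, neg_abs_le t])
  rw [softsign_of_nonneg (x := |a| + |t|) (by positivity)] at h1
  have h2 : (1 + |t|) / (2 * (1 + |a|)) ≤ (1 + t ^ 2) * (1 / (1 + (|a| + |t|))) := by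
    rw [mul_one_div, div_le_div_iff₀ (by positivity) (by positivity), ← sq_abs t]
    nlinarith [abs_nonneg a, abs_nonneg t, sq_nonneg (|t| - 1),
      mul_nonneg (abs_nonneg a) (sq_nonneg (|t|)), mul_nonneg (abs_nonneg a) (abs_nonneg t),
      mul_nonneg (abs_nonneg a) (sq_nonneg (|t| - 1))]
  refine h2.trans ?_
  gcongr
  linarith

/-- To the right the orbit still has to pass `t`, so the second factor stays away from `0` and a
full second moment is detected; to the left it decays like `1 / |t|`. -/
lemma one_sub_softsign_ge_of_nonneg (a : ℝ) {t : ℝ} (ht : 0 ≤ t) :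
    t ^ 2 / (1 + |a|) ≤ (1 + t ^ 2) * (1 - softsign (a - t)) := by
  have h1 : softsign (a - t) ≤ softsign |a| := monotone_softsign (by linarith [le_abs_self a])
  rw [softsign_of_nonneg (abs_nonneg a)] at h1
  rw [div_eq_mul_one_div]
  gcongr
  · linarith
  · linarith

/-! ### Moment conditions and the Cauchy-type integral -/

/-- The majorant `1 + |t|` on the negative axis, `1 + |t| + t ^ 2` on the positive axis. -/
noncomputable def sideMajorant (t : ℝ) : ℝ := 1 + |t| + (Ioi (0 : ℝ)).indicator (fun t => t ^ 2) t

lemma sideMajorant_of_pos {t : ℝ} (ht : 0 < t) : sideMajorant t = 1 + |t| + t ^ 2 := by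
  simp [sideMajorant, ht]

lemma sideMajorant_of_nonpos {t : ℝ} (ht : t ≤ 0) : sideMajorant t = 1 + |t| := by
  simp [sideMajorant, ht]

lemma one_sub_softsign_neg_le (t : ℝ) :
    (1 + t ^ 2) * (1 - softsign (-t)) ≤ 2 * sideMajorant t := by
  rcases lt_or_ge 0 t with ht | ht
  · rw [sideMajorant_of_pos ht]
    have := neg_one_le_softsign (-t)
    nlinarith [abs_nonneg t, sq_nonneg t]
  · rw [sideMajorant_of_nonpos ht, softsign_of_nonneg (by linarith), abs_of_nonpos ht,
      sub_sub_cancel, mul_one_div, div_le_iff₀ (by linarith)]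
    nlinarith

/-- Integrability of `|t|` together with square integrability on the positive axis. -/
lemma integrable_sideMajorant {μ : Measure ℝ} [IsFiniteMeasure μ]
    (h1 : IntegrableOn (fun t : ℝ => |t|) (Iio 0) μ)
    (h2 : IntegrableOn (fun t : ℝ => t ^ 2) (Ioi 0) μ) : Integrable sideMajorant μ := by
  have h3 : Integrable (fun t : ℝ => 2 + (Iio (0 : ℝ)).indicator (fun t => |t|) t +
      2 * (Ioi (0 : ℝ)).indicator (fun t => t ^ 2) t) μ :=
    ((integrable_const 2).add (h1.integrable_indicator measurableSet_Iio)).add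
      ((h2.integrable_indicator measurableSet_Ioi).const_mul 2)
  refine h3.mono' (Measurable.aestronglyMeasurable ?_) (ae_of_all _ fun t => ?_)
  · unfold sideMajorant
    exact (by fun_prop : Measurable fun t : ℝ => 1 + |t|).add
      ((by fun_prop : Measurable fun t : ℝ => t ^ 2).indicator measurableSet_Ioi)
  · rcases lt_trichotomy t 0 with ht | rfl | ht
    · rw [sideMajorant_of_nonpos ht.le, Real.norm_of_nonneg (by positivity)]
      simp [ht, ht.le]
    · simp [sideMajorant]
    · rw [sideMajorant_of_pos ht, Real.norm_of_nonneg (by positivity)]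
      simp [ht, ht.le, abs_of_pos ht]
      nlinarith [sq_nonneg (t - 1)]

lemma integrable_id_of_sideMajorant {μ : Measure ℝ} (h : Integrable sideMajorant μ) :
    Integrable (fun t : ℝ => t) μ :=
  h.mono' measurable_id.aestronglyMeasurable (ae_of_all _ fun t => by
    have : 0 ≤ (Ioi (0 : ℝ)).indicator (fun t => t ^ 2) t :=
      indicator_nonneg (fun t _ => sq_nonneg t) t
    rw [Real.norm_eq_abs, sideMajorant]
    linarith)

lemma herglotz_eq_of_integrable {β : ℝ} {μ : Measure ℝ} [IsFiniteMeasure μ]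
    (h : Integrable (fun t : ℝ => t) μ) {z : ℂ} (hz : 0 < z.im) :
    herglotz β μ z = ((β - ∫ t : ℝ, t ∂μ : ℝ) : ℂ) +
      ∫ t : ℝ, (1 + (t : ℂ) ^ 2) / ((t : ℂ) - z) ∂μ := by
  have h1 : ∀ t : ℝ, (1 + (t : ℂ) ^ 2) / ((t : ℂ) - z) =
      (1 + (t : ℂ) * z) / ((t : ℂ) - z) + (t : ℂ) := fun t => by
    have := ofReal_sub_ne_zero hz t
    field_simp
    ring
  have h2 : Integrable (fun t : ℝ => (t : ℂ)) μ := h.ofReal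
  simp_rw [h1]
  rw [integral_add (integrable_herglotzKernel hz) h2, integral_complex_ofReal, herglotz]
  push_cast
  ring

/-- The Cauchy-type integral vanishes at infinity in quadrants to the right of the origin. -/
lemma tendsto_cauchyIntegral {μ : Measure ℝ} (h : Integrable sideMajorant μ) {y : ℝ}
    (hy : 0 < y) :
    Tendsto (fun z : ℂ => ∫ t : ℝ, (1 + (t : ℂ) ^ 2) / ((t : ℂ) - z) ∂μ)
      (comap norm atTop ⊓ 𝓟 {z : ℂ | 0 ≤ z.re ∧ y ≤ z.im}) (𝓝 0) := by
  have hmem : ∀ᶠ z : ℂ in comap norm atTop ⊓ 𝓟 {z : ℂ | 0 ≤ z.re ∧ y ≤ z.im},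
      0 ≤ z.re ∧ y ≤ z.im := mem_inf_of_right (mem_principal_self _)
  have := tendsto_integral_filter_of_dominated_convergence (μ := μ)
    (l := comap norm atTop ⊓ 𝓟 {z : ℂ | 0 ≤ z.re ∧ y ≤ z.im})
    (F := fun (z : ℂ) (t : ℝ) => (1 + (t : ℂ) ^ 2) / ((t : ℂ) - z)) (f := fun _ => 0)
    (fun t => (1 + 1 / y) * sideMajorant t) ?_ ?_ (h.const_mul _) ?_
  · simpa using this
  · exact Eventually.of_forall fun z => Measurable.aestronglyMeasurable (by fun_prop)
  · filter_upwards [hmem] with z hz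
    refine ae_of_all _ fun t => ?_
    have h3 : ‖(1 : ℂ) + (t : ℂ) ^ 2‖ = 1 + t ^ 2 := by
      rw [← Complex.ofReal_pow, ← Complex.ofReal_one, ← Complex.ofReal_add, Complex.norm_real,
        Real.norm_of_nonneg (by positivity)]
    -- For `t > 0` only the height bound `h4` is used; for `t ≤ 0 ≤ Re z` also `|t| ≤ ‖t - z‖`,
    -- which saves one power of `|t|`.
    have h4 : y ≤ ‖(t : ℂ) - z‖ := hz.2.trans (im_le_norm_ofReal_sub t z)
    have h5 : z.re - t ≤ ‖(t : ℂ) - z‖ := by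
      have := (neg_le_abs _).trans (Complex.abs_re_le_norm ((t : ℂ) - z))
      simpa using this
    rw [norm_div, h3, div_le_iff₀ (by linarith)]
    generalize ‖(t : ℂ) - z‖ = r at *
    have h6 : 1 ≤ 1 / y * r := by rw [one_div, inv_mul_eq_div, le_div_iff₀ hy]; linarith
    have h7 : 0 < r := hy.trans_le h4
    rcases lt_or_ge 0 t with ht | ht
    · rw [sideMajorant_of_pos ht]
      have h8 : 0 ≤ 1 + |t| + t ^ 2 := by positivity
      nlinarith [mul_le_mul_of_nonneg_left h6 h8, mul_nonneg h8 h7.le, abs_nonneg t]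
    · rw [sideMajorant_of_nonpos ht, abs_of_nonpos ht]
      nlinarith [mul_nonneg (neg_nonneg.2 ht) h7.le,
        mul_le_mul_of_nonneg_left h6 (neg_nonneg.2 ht), hz.1]
  · refine ae_of_all _ fun t => ?_
    have h1 : Tendsto (fun z : ℂ => ‖(t : ℂ) - z‖) (comap norm atTop) atTop := by
      refine tendsto_atTop_mono (f := fun z : ℂ => ‖z‖ - ‖(t : ℂ)‖) (fun z => ?_)
        (tendsto_atTop_add_const_right _ _ tendsto_comap)
      rw [norm_sub_rev]
      exact norm_sub_norm_le _ _
    have h2 : Tendsto (fun z : ℂ => ‖(1 : ℂ) + (t : ℂ) ^ 2‖ / ‖(t : ℂ) - z‖)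
        (comap norm atTop) (𝓝 0) := tendsto_const_nhds.div_atTop h1
    rw [tendsto_zero_iff_norm_tendsto_zero]
    simp_rw [norm_div]
    exact h2.mono_left inf_le_left

lemma tendsto_atTop_of_tendsto_sub {x : ℕ → ℝ} {b : ℝ} (hb : 0 < b)
    (h : Tendsto (fun n => x (n + 1) - x n) atTop (𝓝 b)) : Tendsto x atTop atTop := by
  obtain ⟨N, hN⟩ := eventually_atTop.1 (h.eventually_const_lt (half_lt_self hb))
  rw [← tendsto_add_atTop_iff_nat N]
  have h1 : ∀ k : ℕ, x N + k * (b / 2) ≤ x (k + N) := fun k => by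
    induction k with
    | zero => simp
    | succ k ih =>
      have := hN (k + N) (Nat.le_add_left _ _)
      rw [show k + 1 + N = k + N + 1 by ring]
      push_cast
      linarith
  exact tendsto_atTop_mono h1 (tendsto_atTop_add_const_left _ _
    (tendsto_natCast_atTop_atTop.atTop_mul_const (by positivity)))

/-! ### Orbits moving to the right -/

namespace IsHerglotzOrbit

lemma re_succ_sub {β : ℝ} {μ : Measure ℝ} {z : ℕ → ℂ}
    (h : IsHerglotzOrbit β μ z) (n : ℕ) :
    (z (n + 1)).re - (z n).re = (herglotz β μ (z n)).re := by
  rw [h.succ_eq, Complex.add_re]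
  ring

lemma reflect {β : ℝ} {μ : Measure ℝ} {z : ℕ → ℂ}
    (h : IsHerglotzOrbit β μ z) :
    IsHerglotzOrbit (-β) (μ.map (MeasurableEquiv.neg ℝ))
      (fun n => -(starRingEnd ℂ) (z n)) where
  im_zero_pos := by simpa using h.im_zero_pos
  succ_eq n := by
    have key : herglotz (-β) (μ.map (MeasurableEquiv.neg ℝ)) (-(starRingEnd ℂ) (z n)) =
        -(starRingEnd ℂ) (herglotz β μ (z n)) := by
      rw [herglotz, herglotz, integral_map_equiv, map_add, ← integral_conj, neg_add,
        ← integral_neg, Complex.conj_ofReal, Complex.ofReal_neg]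
      congr 1
      refine integral_congr_ae (ae_of_all _ fun t => ?_)
      simp only [MeasurableEquiv.neg_apply, Complex.ofReal_neg, map_div₀, map_add, map_mul,
        map_sub, map_one, Complex.conj_ofReal, ← div_neg]
      congr 1 <;> ring
    simp only [key, h.succ_eq n, map_add]
    ring

end IsHerglotzOrbit

section Orbits

variable {β : ℝ} {μ : Measure ℝ} [IsFiniteMeasure μ] {z : ℕ → ℂ}

namespace IsHerglotzOrbit

lemma tendsto_cauchyIntegral (h : IsHerglotzOrbit β μ z) (hμ : Integrable sideMajorant μ)
    (hx : Tendsto (fun n => (z n).re) atTop atTop) :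
    Tendsto (fun n => ∫ t : ℝ, (1 + (t : ℂ) ^ 2) / ((t : ℂ) - z n) ∂μ) atTop (𝓝 0) := by
  refine (_root_.tendsto_cauchyIntegral hμ h.im_zero_pos).comp (tendsto_inf.2 ⟨?_, ?_⟩)
  · exact tendsto_comap_iff.2 (tendsto_atTop_mono (fun n => Complex.re_le_norm (z n)) hx)
  · rw [tendsto_principal]
    filter_upwards [hx.eventually_ge_atTop 0] with n hn
    exact ⟨hn, h.monotone_im (Nat.zero_le n)⟩

/-- Softsign increments along the orbit are dominated by the kernel. They telescope to the integrand
as `Re z n → ∞`, and Tonelli bounds its integral by a multiple of `∑ P (z n)`. -/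
lemma integrable_one_sub_softsign (h : IsHerglotzOrbit β μ z)
    (hb : BddAbove (range fun n => (z n).im))
    (hx : Tendsto (fun n => (z n).re) atTop atTop) {H : ℝ} (hH0 : 0 ≤ H)
    (hH : ∀ n, (z (n + 1)).re ≤ (z n).re + H) :
    Integrable (fun t : ℝ => (1 + t ^ 2) * (1 - softsign ((z 0).re - t))) μ := by
  have hP := h.summable_weightedPoissonIntegral hb
  obtain ⟨B, hB⟩ := hb
  have hzB : ∀ n, (z n).im ≤ B := fun n => hB ⟨n, rfl⟩
  have hB0 : 0 < B := h.im_zero_pos.trans_le (hzB 0)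
  set C : ℝ := H * (1 + H) ^ 2 * (1 + B) ^ 2 with hC
  have hC0 : 0 ≤ C := by positivity
  have hstep : ∀ (t : ℝ) (n : ℕ),
      (1 + t ^ 2) * (softsign ((z (n + 1)).re - t) - softsign ((z n).re - t)) ≤
        C * weightedPoissonKernel (z n) t := fun t n => by
    have h1 := softsign_sub_le (u := (z n).re - t) (v := (z (n + 1)).re - t) hH0
      (by linarith [hH n])
    have h2 := mul_le_mul_of_nonneg_left (le_weightedPoissonKernel (h.im_pos n) (hzB n) t) hC0
    refine (mul_le_mul_of_nonneg_left h1 (by positivity)).trans (le_of_eq_of_le ?_ h2)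
    rw [hC]
    field_simp
  have hsum : ∀ (t : ℝ) (n : ℕ),
      (1 + t ^ 2) * (softsign ((z n).re - t) - softsign ((z 0).re - t)) ≤
        ∑ i ∈ Finset.range n, C * weightedPoissonKernel (z i) t := fun t n => by
    rw [← Finset.sum_range_sub (fun i => softsign ((z i).re - t)), Finset.mul_sum]
    exact Finset.sum_le_sum fun i _ => hstep t i
  have hK0 : ∀ (i : ℕ) (t : ℝ), 0 ≤ C * weightedPoissonKernel (z i) t := fun i t =>
    mul_nonneg hC0 (weightedPoissonKernel_nonneg _ _)
  have hpt : ∀ t : ℝ, ENNReal.ofReal ((1 + t ^ 2) * (1 - softsign ((z 0).re - t))) ≤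
      ∑' i, ENNReal.ofReal (C * weightedPoissonKernel (z i) t) := fun t => by
    have hlim : Tendsto (fun n => ENNReal.ofReal
        ((1 + t ^ 2) * (softsign ((z n).re - t) - softsign ((z 0).re - t)))) atTop
        (𝓝 (ENNReal.ofReal ((1 + t ^ 2) * (1 - softsign ((z 0).re - t))))) :=
      ENNReal.tendsto_ofReal (((tendsto_softsign_atTop.comp
        (tendsto_atTop_add_const_right _ (-t) hx)).sub_const _).const_mul _)
    refine le_of_tendsto' hlim fun n => ?_
    refine (ENNReal.ofReal_le_ofReal (hsum t n)).trans ?_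
    rw [ENNReal.ofReal_sum_of_nonneg fun i _ => hK0 i t]
    exact ENNReal.sum_le_tsum _
  refine ⟨Measurable.aestronglyMeasurable (by fun_prop), ?_⟩
  rw [hasFiniteIntegral_iff_ofReal (ae_of_all _ fun t => mul_nonneg (by positivity)
    (sub_nonneg.2 (softsign_le_one _)))]
  refine (lintegral_mono hpt).trans_lt ?_
  rw [lintegral_tsum fun i => by fun_prop]
  have hint : ∀ i, ∫⁻ t, ENNReal.ofReal (C * weightedPoissonKernel (z i) t) ∂μ =
      ENNReal.ofReal (C * weightedPoissonIntegral μ (z i)) := fun i => by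
    rw [weightedPoissonIntegral, ← integral_const_mul, ofReal_integral_eq_lintegral_ofReal
      ((integrable_weightedPoissonKernel (h.im_pos i)).const_mul C) (ae_of_all _ (hK0 i))]
  simp_rw [hint]
  rw [← ENNReal.ofReal_tsum_of_nonneg
    (fun i => mul_nonneg hC0 (weightedPoissonIntegral_nonneg _ _)) (hP.mul_left C)]
  exact ENNReal.ofReal_lt_top

/-- An orbit with bounded imaginary parts moving to the right. -/
lemma integrability_of_tendsto (h : IsHerglotzOrbit β μ z)
    (hb : BddAbove (range fun n => (z n).im)) {b : ℝ} (hb0 : 0 < b)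
    (hlim : Tendsto (fun n => herglotz β μ (z n)) atTop (𝓝 (b : ℂ))) :
    IntegrableOn (fun t : ℝ => |t|) (Iio 0) μ ∧ IntegrableOn (fun t : ℝ => t ^ 2) (Ioi 0) μ ∧
      (∫ t : ℝ, t ∂μ) < β := by
  have hre : Tendsto (fun n => (z (n + 1)).re - (z n).re) atTop (𝓝 b) := by
    simp_rw [h.re_succ_sub]
    exact (Complex.continuous_re.tendsto _).comp hlim
  have hx : Tendsto (fun n => (z n).re) atTop atTop :=
    tendsto_atTop_of_tendsto_sub (x := fun n => (z n).re) hb0 hre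
  obtain ⟨H, hH⟩ := hre.bddAbove_range
  have hG := h.integrable_one_sub_softsign hb hx (le_max_left 0 H) fun n => by
    have : (z (n + 1)).re - (z n).re ≤ H := hH ⟨n, rfl⟩
    linarith [le_max_right 0 H]
  have h1 : IntegrableOn (fun t : ℝ => |t|) (Iio 0) μ := by
    refine Integrable.integrableOn ?_
    refine (hG.const_mul (2 * (1 + |(z 0).re|))).mono'
      (Measurable.aestronglyMeasurable (by fun_prop)) (ae_of_all _ fun t => ?_)
    have := one_sub_softsign_ge (z 0).re t
    rw [div_le_iff₀' (by positivity)] at this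
    rw [Real.norm_eq_abs, abs_abs]
    linarith
  have h2 : IntegrableOn (fun t : ℝ => t ^ 2) (Ioi 0) μ := by
    refine (hG.const_mul (1 + |(z 0).re|)).integrableOn.mono'
      (Measurable.aestronglyMeasurable (by fun_prop))
      ((ae_restrict_iff' measurableSet_Ioi).2 (ae_of_all _ fun t ht => ?_))
    have := one_sub_softsign_ge_of_nonneg (z 0).re (le_of_lt ht)
    rw [div_le_iff₀' (by positivity)] at this
    rwa [Real.norm_of_nonneg (sq_nonneg t)]
  refine ⟨h1, h2, ?_⟩
  have hμ := integrable_sideMajorant h1 h2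
  have hlim' : Tendsto (fun n => herglotz β μ (z n)) atTop
      (𝓝 (((β - ∫ t : ℝ, t ∂μ : ℝ) : ℂ) + 0)) := by
    simp_rw [fun n => herglotz_eq_of_integrable (β := β) (integrable_id_of_sideMajorant hμ)
      (h.im_pos n)]
    exact (h.tendsto_cauchyIntegral hμ hx).const_add _
  have hb' := tendsto_nhds_unique hlim hlim'
  rw [add_zero, Complex.ofReal_inj] at hb'
  linarith

/-- Steps of length at least `a` prevent the orbit from accumulating near any `t`, so the kernel is
dominated by softsign increments, whose telescoped sum is bounded uniformly in `n`. -/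
lemma sum_weightedPoissonIntegral_le (h : IsHerglotzOrbit β μ z) (hμ : Integrable sideMajorant μ)
    (h0 : (z 0).re = 0) (hz1 : 1 ≤ (z 0).im) {a H : ℝ} (ha : 0 < a)
    (hlow : ∀ n, (z n).re + a ≤ (z (n + 1)).re) (hup : ∀ n, (z (n + 1)).re ≤ (z n).re + H)
    (n : ℕ) : ∑ i ∈ Finset.range n, weightedPoissonIntegral μ (z i) ≤
      2 * (1 + H) / a * ∫ t, 2 * sideMajorant t ∂μ := by
  have hH : 0 < H := by linarith [hlow 0, hup 0]
  simp_rw [weightedPoissonIntegral]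
  rw [← integral_finsetSum _ fun i _ => integrable_weightedPoissonKernel (h.im_pos i),
    ← integral_const_mul]
  refine integral_mono (integrable_finsetSum _ fun i _ =>
    integrable_weightedPoissonKernel (h.im_pos i)) ((hμ.const_mul 2).const_mul _) fun t => ?_
  have hstep : ∀ i, weightedPoissonKernel (z i) t ≤ 2 * (1 + H) / a *
      ((1 + t ^ 2) * (softsign ((z (i + 1)).re - t) - softsign ((z i).re - t))) := fun i => by
    have h1 := weightedPoissonKernel_le_of_one_le_im
      (hz1.trans (h.monotone_im (Nat.zero_le i))) t
    have h2 := le_softsign_sub_of_step (u := (z i).re - t) (v := (z (i + 1)).re - t) (H := H) ha.le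
      (by linarith [hlow i]) (by linarith [hup i])
    have h3 := mul_le_mul_of_nonneg_left h2
      (show 0 ≤ 2 * (1 + H) / a * (1 + t ^ 2) by positivity)
    rw [mul_assoc] at h3
    refine h1.trans (le_of_eq_of_le ?_ (h3.trans_eq (mul_assoc _ _ _)))
    field_simp
  calc ∑ i ∈ Finset.range n, weightedPoissonKernel (z i) t
      ≤ ∑ i ∈ Finset.range n, 2 * (1 + H) / a *
        ((1 + t ^ 2) * (softsign ((z (i + 1)).re - t) - softsign ((z i).re - t))) :=
        Finset.sum_le_sum fun i _ => hstep i
    _ = 2 * (1 + H) / a * ((1 + t ^ 2) * (softsign ((z n).re - t) - softsign (-t))) := by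
        rw [← Finset.mul_sum, ← Finset.mul_sum,
          Finset.sum_range_sub (fun i => softsign ((z i).re - t)), h0, zero_sub]
    _ ≤ 2 * (1 + H) / a * (2 * sideMajorant t) := by
        refine mul_le_mul_of_nonneg_left (le_trans ?_ (one_sub_softsign_neg_le t)) (by positivity)
        gcongr
        exact softsign_le_one _

end IsHerglotzOrbit

/-- Under the moment conditions, orbits starting high on the imaginary axis have bounded
imaginary parts. -/
lemma exists_forall_bddAbove_im (hμ : Integrable sideMajorant μ) (hβ : (∫ t : ℝ, t ∂μ) < β) :
    ∃ Y : ℝ, 0 < Y ∧ ∀ z : ℕ → ℂ, IsHerglotzOrbit β μ z → z 0 = (Y : ℂ) * Complex.I →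
      BddAbove (range fun n => (z n).im) := by
  set b := β - ∫ t : ℝ, t ∂μ with hb
  have hb0 : 0 < b := sub_pos.2 hβ
  have hev := (tendsto_cauchyIntegral hμ one_pos).norm.eventually_lt_const
    (show ‖(0 : ℂ)‖ < b / 2 by rw [norm_zero]; linarith)
  rw [eventually_inf_principal, eventually_comap, eventually_atTop] at hev
  obtain ⟨R, hR⟩ := hev
  have hdisp : ∀ w : ℂ, 0 ≤ w.re → max 1 R ≤ w.im →
      |(herglotz β μ w).re - b| ≤ b / 2 := fun w hw1 hw2 => by
    have hw3 : 1 ≤ w.im := (le_max_left _ _).trans hw2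
    have := hR ‖w‖ ((le_max_right _ _).trans (hw2.trans (Complex.im_le_norm w))) w rfl ⟨hw1, hw3⟩
    rw [herglotz_eq_of_integrable (integrable_id_of_sideMajorant hμ) (by linarith),
      Complex.add_re, Complex.ofReal_re, add_sub_cancel_left]
    exact (Complex.abs_re_le_norm _).trans this.le
  -- Height `1` serves the kernel bound; height `R` forces `‖z‖ ≥ R`. Real steps then lie between `b
  -- / 2` and `3 * b / 2`, so the orbit never leaves the quadrant.
  refine ⟨max 1 R, by positivity, fun z h hz0 => ?_⟩
  have h0re : (z 0).re = 0 := by rw [hz0]; simp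
  have h0im : (z 0).im = max 1 R := by rw [hz0]; simp
  have him : ∀ n, max 1 R ≤ (z n).im := fun n => h0im.ge.trans (h.monotone_im (Nat.zero_le n))
  have hre : ∀ n, 0 ≤ (z n).re := fun n => by
    induction n with
    | zero => exact h0re.ge
    | succ n ih =>
      have := abs_le.1 (hdisp (z n) ih (him n))
      linarith [h.re_succ_sub n]
  have hd := fun n => abs_le.1 (hdisp (z n) (hre n) (him n))
  exact h.bddAbove_im_of_sum_le (h.sum_weightedPoissonIntegral_le hμ h0re
    (h0im ▸ le_max_left _ _) (half_pos hb0) (H := 3 * b / 2)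
    (fun n => by linarith [h.re_succ_sub n, (hd n).1])
    (fun n => by linarith [h.re_succ_sub n, (hd n).2]))

end Orbits

/-! ### Reflection and the main theorem -/

lemma integrableOn_map_neg {μ : Measure ℝ} {g : ℝ → ℝ} (hg : ∀ t, g (-t) = g t) {s : Set ℝ} :
    IntegrableOn g s (μ.map (MeasurableEquiv.neg ℝ)) ↔ IntegrableOn g (Neg.neg ⁻¹' s) μ := by
  rw [integrableOn_map_equiv]
  have : g ∘ (MeasurableEquiv.neg ℝ) = g := funext hg
  rw [this]
  rfl

lemma integral_id_map_neg (μ : Measure ℝ) :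
    ∫ t : ℝ, t ∂(μ.map (MeasurableEquiv.neg ℝ)) = -∫ t : ℝ, t ∂μ := by
  rw [integral_map_equiv, ← integral_neg]
  rfl

theorem mainTheorem1 (f : ℍ → ℍ) (hf : IsParabolicAtInfty f)
    (β : ℝ) (μ : Measure ℝ) [IsFiniteMeasure μ]
    (hrep : ∀ z : ℍ, (f z : ℂ) =
      (z : ℂ) + (β : ℂ) + ∫ t : ℝ, (1 + (t : ℂ) * (z : ℂ)) / ((t : ℂ) - (z : ℂ)) ∂μ) :
    (HasFiniteShift f → Integrable (fun t : ℝ => |t|) μ) ∧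
    (HasFiniteShift f ↔
      ((IntegrableOn (fun t : ℝ => |t|) (Set.Iio 0) μ ∧
          IntegrableOn (fun t : ℝ => t ^ 2) (Set.Ioi 0) μ ∧
          (∫ t : ℝ, t ∂μ) < β) ∨
        (IntegrableOn (fun t : ℝ => t ^ 2) (Set.Iio 0) μ ∧
          IntegrableOn (fun t : ℝ => |t|) (Set.Ioi 0) μ ∧
          β < ∫ t : ℝ, t ∂μ))) := by
  set ν := μ.map (MeasurableEquiv.neg ℝ) with hν
  have hfz : ∀ z : ℍ, (f z : ℂ) = z + herglotz β μ z := fun z => by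
    rw [hrep, herglotz, add_assoc]
  have horb : ∀ z₀ : ℍ, IsHerglotzOrbit β μ (fun n => ((f^[n] z₀ : ℍ) : ℂ)) := fun z₀ =>
    ⟨z₀.im_pos, fun n => by rw [Function.iterate_succ_apply', hfz]⟩
  have habs : ∀ {s : Set ℝ}, IntegrableOn (fun t : ℝ => |t|) s ν ↔
      IntegrableOn (fun t : ℝ => |t|) (Neg.neg ⁻¹' s) μ := integrableOn_map_neg abs_neg
  have hsq : ∀ {s : Set ℝ}, IntegrableOn (fun t : ℝ => t ^ 2) s ν ↔
      IntegrableOn (fun t : ℝ => t ^ 2) (Neg.neg ⁻¹' s) μ := integrableOn_map_neg neg_sq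
  have hcond : (IntegrableOn (fun t : ℝ => t ^ 2) (Set.Iio 0) μ ∧
      IntegrableOn (fun t : ℝ => |t|) (Set.Ioi 0) μ ∧ β < ∫ t : ℝ, t ∂μ) ↔
      (IntegrableOn (fun t : ℝ => |t|) (Set.Iio 0) ν ∧
        IntegrableOn (fun t : ℝ => t ^ 2) (Set.Ioi 0) ν ∧ (∫ t : ℝ, t ∂ν) < -β) := by
    rw [habs, hsq, integral_id_map_neg, neg_lt_neg_iff]
    simp only [neg_preimage, neg_Iio, neg_Ioi, neg_zero]
    tauto
  have hnec : HasFiniteShift f →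
      ((IntegrableOn (fun t : ℝ => |t|) (Set.Iio 0) μ ∧
          IntegrableOn (fun t : ℝ => t ^ 2) (Set.Ioi 0) μ ∧
          (∫ t : ℝ, t ∂μ) < β) ∨
        (IntegrableOn (fun t : ℝ => t ^ 2) (Set.Iio 0) μ ∧
          IntegrableOn (fun t : ℝ => |t|) (Set.Ioi 0) μ ∧
          β < ∫ t : ℝ, t ∂μ)) := by
    rintro ⟨z₀, hz₀⟩
    obtain ⟨b, hb0, hlim⟩ := (horb z₀).tendsto_herglotz hz₀ fun n h0 =>
      hf.no_fixed_point (f^[n] z₀) (UpperHalfPlane.ext (by rw [hfz, h0, add_zero]))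
    rcases hb0.lt_or_gt with hb | hb
    · right
      rw [hcond]
      -- The reflected orbit has displacement `-conj (h (z n))`, with limit `-b > 0`.
      refine (horb z₀).reflect.integrability_of_tendsto (by simpa using hz₀) (neg_pos.2 hb) ?_
      have hlim' := ((Complex.continuous_conj.tendsto _).comp hlim).neg
      rw [Complex.conj_ofReal, ← Complex.ofReal_neg] at hlim'
      refine hlim'.congr fun n => ?_
      have h1 := (horb z₀).succ_eq n
      have h2 := (horb z₀).reflect.succ_eq n
      simp only [h1, map_add, neg_add] at h2
      exact add_left_cancel h2
    · exact Or.inl ((horb z₀).integrability_of_tendsto hz₀ hb hlim)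
  have hint : ∀ {μ' : Measure ℝ} [IsFiniteMeasure μ'], Integrable sideMajorant μ' →
      Integrable (fun t : ℝ => |t|) μ' := fun h => (integrable_id_of_sideMajorant h).abs
  refine ⟨fun h => ?_, hnec, ?_⟩
  · rcases hnec h with ⟨h1, h2, _⟩ | h'
    · exact hint (integrable_sideMajorant h1 h2)
    · obtain ⟨h1, h2, _⟩ := hcond.1 h'
      have := hint (integrable_sideMajorant h1 h2)
      rw [← integrableOn_univ, habs, preimage_univ, integrableOn_univ] at this
      exact this
  · rintro (⟨h1, h2, h3⟩ | h')
    · obtain ⟨Y, hY, H⟩ := exists_forall_bddAbove_im (integrable_sideMajorant h1 h2) h3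
      refine ⟨⟨Y * Complex.I, by simpa using hY⟩, ?_⟩
      exact H _ (horb _) rfl
    · obtain ⟨h1, h2, h3⟩ := hcond.1 h'
      obtain ⟨Y, hY, H⟩ := exists_forall_bddAbove_im (integrable_sideMajorant h1 h2) h3
      refine ⟨⟨Y * Complex.I, by simpa using hY⟩, ?_⟩
      simpa using H _ (horb ⟨Y * Complex.I, by simpa using hY⟩).reflect (by simp)
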